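/- Let $\mathcal H$ be a finite-dimensional complex Hilbert space of dimension $d$, let $\mathcal L(\mathcal H)$ be the algebra of linear operators on $\mathcal H$ and $\mathcal L(\mathcal L(\mathcal H))$ the algebra of linear maps on $\mathcal L(\mathcal H)$. A quantum dynamical semigroup (QDS) on $\mathcal L(\mathcal H)$ is a family $(\Lambda_t)_{t\ge 0}$ in $\mathcal L(\mathcal L(\mathcal H))$ such that $\Lambda_0$ is the identity, $\Lambda_{t+s}=\Lambda_t\circ\Lambda_s$ for all $t,s\ge 0$, $t\mapsto\Lambda_t$ is continuous on $[0,\infty)$, and every $\Lambda_t$ is completely positive and unital ($\Lambda_t(\mathbb 1)=\mathbb 1$). Write $[A,B]=AB-BA$ and $\{A,B\}=AB+BA$. (a) Every QDS $(\Lambda_t)_{t\ge0}$ has a generator $L=\lim_{t\to0+}(\Lambda_t-\mathrm{id})/t\in\mathcal L(\mathcal L(\mathcal H))$, one has $\Lambda_t=\exp(tL)$ for all $t\ge 0$, and there are an integer $N\ge 1$, a self-adjoint $H\in\mathcal L(\mathcal H)$ and $V_1,\dots,V_N\in\mathcal L(\mathcal H)$ with $$L(A)=i[H,A]+\sum_{j=1}^{N}\Bigl(V_j^\dagger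 A V_j-\tfrac12\{V_j^\dagger V_j,A\}\Bigr)\qquad(A\in\mathcal L(\mathcal H)).\tag{$*$}$$ Moreover, $H$ (self-adjoint) and $V_1,\dots,V_N$ in $(*)$ can be chosen all traceless with, at the same time, $N\le d^2-1$ (and still $N\ge1$ if $d\ge2$; for $d\le 1$ this means $N=0$ and the sum is empty). (b) Conversely, if $L\in\mathcal L(\mathcal L(\mathcal H))$ is given by $(*)$ for some integer $N\ge0$, some self-adjoint $H\in\mathcal L(\mathcal H)$ and some $V_1,\dots,V_N\in\mathcal L(\mathcal H)$, then $(\exp(tL))_{t\ge0}$ is a QDS. -/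

import Mathlib

open scoped NNReal Topology CStarAlgebra

/-- The algebra `L(𝓗)` of operators on `𝓗`. When `𝓗` is finite-dimensional every linear operator
is continuous, so this is the space of all linear operators. -/
abbrev Op (𝓗 : Type*) [NormedAddCommGroup 𝓗] [InnerProductSpace ℂ 𝓗] : Type _ := 𝓗 →L[ℂ] 𝓗

/-- The algebra `L(L(𝓗))` of linear maps on `L(𝓗)` (all of them, if `𝓗` is finite-dimensional);
the product is composition and `1` is the identity map. -/
abbrev SuperOp (𝓗 : Type*) [NormedAddCommGroup 𝓗] [InnerProductSpace ℂ 𝓗] : Type _ :=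
  Op 𝓗 →L[ℂ] Op 𝓗

section

variable {𝓗 : Type*} [NormedAddCommGroup 𝓗] [InnerProductSpace ℂ 𝓗]

/-- `Φ` is completely positive: it is the underlying map of a completely positive map
`L(𝓗) →CP L(𝓗)`, that is, all its entrywise amplifications to `k × k` matrices over `L(𝓗)`
preserve positivity. -/
def IsCompletelyPositive [CompleteSpace 𝓗] (Φ : SuperOp 𝓗) : Prop :=
  ∃ φ : Op 𝓗 →CP Op 𝓗, ∀ A : Op 𝓗, φ A = Φ A

/-- A one-parameter semigroup of linear maps on `L(𝓗)`. -/
structure IsOneParameterSemigroup (Λ : ℝ≥0 → SuperOp 𝓗) : Prop where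
  map_zero : Λ 0 = 1
  map_add : ∀ t s : ℝ≥0, Λ (t + s) = Λ t * Λ s
  continuous : Continuous Λ

/-- A quantum dynamical semigroup (in the Heisenberg picture): a one-parameter semigroup of unital
completely positive maps on `L(𝓗)`. -/
structure IsQDS [CompleteSpace 𝓗] (Λ : ℝ≥0 → SuperOp 𝓗) : Prop
    extends IsOneParameterSemigroup Λ where
  completelyPositive : ∀ t : ℝ≥0, IsCompletelyPositive (Λ t)
  unital : ∀ t : ℝ≥0, Λ t 1 = 1

/-- `L` is the generator of the family `Λ`: `L = lim_{t → 0+} (Λ t - 1) / t`. -/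
def IsGenerator (Λ : ℝ≥0 → SuperOp 𝓗) (L : SuperOp 𝓗) : Prop :=
  Filter.Tendsto (fun t : ℝ≥0 => (t : ℝ)⁻¹ • (Λ t - 1)) (𝓝[>] 0) (𝓝 L)

/-- `L(A) = i[H, A] + ∑ j, (V j† A V j - ½ {V j† V j, A})` for all `A`. -/
def HasGKSLForm [CompleteSpace 𝓗] (L : SuperOp 𝓗) {N : ℕ} (H : Op 𝓗) (V : Fin N → Op 𝓗) : Prop :=
  ∀ A : Op 𝓗, L A = Complex.I • (H * A - A * H) +
    ∑ j, (star (V j) * A * V j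
      - (1 / 2 : ℂ) • (star (V j) * V j * A + A * (star (V j) * V j)))

/-- The operator `A` has trace zero. -/
def IsTraceless (A : Op 𝓗) : Prop := LinearMap.trace ℂ 𝓗 (A : 𝓗 →ₗ[ℂ] 𝓗) = 0

end

/-! ### Complete positivity: closure properties, Kraus sums, quadratic forms. -/

section CompletelyPositive

variable {𝓗 : Type*} [NormedAddCommGroup 𝓗] [InnerProductSpace ℂ 𝓗] [CompleteSpace 𝓗]

/-! Norm continuity makes a semigroup smooth after averaging over a short interval, hence an
exponential (`exists_eq_exp_smul_of_semigroup`). For (a), differentiating complete positivity at `t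
= 0` leaves positivity of `cpForm A x L` only on the constraint `∑ A i (x i) = 0`. Lindblad's device
removes the constraint: one extra pair built from a unit vector `e` restores it for arbitrary data,
and its contribution is exactly that of a term `A ↦ K† A + A K` (`exists_cpForm_sub_nonneg`). What
remains is completely positive, so its Choi matrix factors and gives Kraus operators
(`exists_kraus_of_cpForm_nonneg`). Shifting these by scalars makes them traceless, a Gram matrix
argument reduces their number to the dimension of the traceless operators, and `L 1 = 0` fixes the
Hermitian part of `K`, the rest being the Hamiltonian. For (b), `L` is a Kraus sum plus `K† A + A
K`. Up to an error of order `h ^ 2`, `1 + h L` is a Kraus sum, so `exp (t L)` is a limit of powers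
of completely positive maps (`isCompletelyPositive_exp_smul`). -/

theorem isCompletelyPositive_iff {Φ : SuperOp 𝓗} :
    IsCompletelyPositive Φ ↔
      ∀ (k : ℕ) (M : CStarMatrix (Fin k) (Fin k) (Op 𝓗)), 0 ≤ M → 0 ≤ M.map Φ := by
  constructor
  · rintro ⟨φ, hφ⟩ k M hM
    have h := φ.map_cstarMatrix_nonneg M hM
    rwa [show M.map φ = M.map Φ from CStarMatrix.ext fun i j => hφ _] at h
  · intro h
    exact ⟨{ toLinearMap := Φ, map_cstarMatrix_nonneg' := fun k M hM => h k M hM }, fun A => rfl⟩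

theorem IsCompletelyPositive.one : IsCompletelyPositive (1 : SuperOp 𝓗) :=
  isCompletelyPositive_iff.2 fun _ _ hM => hM

theorem IsCompletelyPositive.mul {Φ Ψ : SuperOp 𝓗} (hΦ : IsCompletelyPositive Φ)
    (hΨ : IsCompletelyPositive Ψ) : IsCompletelyPositive (Φ * Ψ) := by
  rw [isCompletelyPositive_iff] at *
  exact fun k M hM => hΦ k _ (hΨ k M hM)

theorem IsCompletelyPositive.pow {Φ : SuperOp 𝓗} (hΦ : IsCompletelyPositive Φ) (n : ℕ) :
    IsCompletelyPositive (Φ ^ n) := by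
  induction n with
  | zero => simpa using IsCompletelyPositive.one
  | succ n ih => rw [pow_succ]; exact ih.mul hΦ

/-- Each positive matrix `M` imposes a closed condition, as the positive cone is closed and `M.map
Φ` depends continuously on `Φ`. -/
theorem isClosed_setOf_isCompletelyPositive :
    IsClosed {Φ : SuperOp 𝓗 | IsCompletelyPositive Φ} := by
  simp only [isCompletelyPositive_iff, Set.ofPred_forall]
  refine isClosed_iInter fun k => isClosed_iInter fun M => isClosed_iInter fun _ => ?_
  have hc : Continuous fun Φ : SuperOp 𝓗 => M.map Φ :=
    CStarMatrix.ofMatrixL.continuous.comp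
      (continuous_matrix fun i j => (ContinuousLinearMap.apply ℂ (Op 𝓗) (M i j)).continuous)
  exact CStarAlgebra.isClosed_nonneg.preimage hc

theorem CStarAlgebra.nonneg_iff_exists_star_mul_self {A : Type*} [NonUnitalCStarAlgebra A]
    [PartialOrder A] [StarOrderedRing A] {a : A} : 0 ≤ a ↔ ∃ b, a = star b * b :=
  CStarAlgebra.nonneg_iff_eq_star_mul_self

theorem CStarMatrix.nonneg_iff_exists_entries {k : ℕ}
    {M : CStarMatrix (Fin k) (Fin k) (Op 𝓗)} :
    0 ≤ M ↔ ∃ N : Fin k → Fin k → Op 𝓗, ∀ i j, M i j = ∑ r, star (N r i) * N r j := by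
  refine CStarAlgebra.nonneg_iff_exists_star_mul_self.trans ?_
  constructor
  · rintro ⟨N, rfl⟩
    exact ⟨N, fun i j => by simp [CStarMatrix.mul_apply, CStarMatrix.star_apply]⟩
  · rintro ⟨N, hN⟩
    refine ⟨CStarMatrix.ofMatrix N, CStarMatrix.ext fun i j => ?_⟩
    rw [hN, CStarMatrix.mul_apply]
    rfl

/-- Conjugation by `W a` turns a factorization by `N r i` into one by `N r i * W a`. -/
theorem IsCompletelyPositive.of_kraus {ι : Type*} [Fintype ι] {Φ : SuperOp 𝓗} (W : ι → Op 𝓗)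
    (h : ∀ A, Φ A = ∑ a, star (W a) * A * W a) : IsCompletelyPositive Φ := by
  rw [isCompletelyPositive_iff]
  intro k M hM
  obtain ⟨N, hN⟩ := CStarMatrix.nonneg_iff_exists_entries.1 hM
  have : M.map Φ = ∑ a, (CStarMatrix.ofMatrix fun i j =>
      ∑ r, star (N r i * W a) * (N r j * W a)) := by
    ext1 i j
    have hs : ∀ (s : Finset ι) (f : ι → CStarMatrix (Fin k) (Fin k) (Op 𝓗)),
        (∑ a ∈ s, f a) i j = ∑ a ∈ s, f a i j := fun s f => Matrix.sum_apply i j s f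
    rw [hs]
    simp only [CStarMatrix.map_apply, h, hN, Finset.mul_sum, Finset.sum_mul]
    refine Finset.sum_congr rfl fun a _ => Finset.sum_congr rfl fun r _ => ?_
    rw [star_mul, mul_assoc, mul_assoc, mul_assoc]
  rw [this]
  exact Finset.sum_nonneg fun a _ =>
    CStarMatrix.nonneg_iff_exists_entries.2 ⟨fun r i => N r i * W a, fun i j => rfl⟩

/-- The positivity property of completely positive maps, in terms of quadratic forms. -/
theorem IsCompletelyPositive.re_sum_inner_nonneg {Φ : SuperOp 𝓗} (hΦ : IsCompletelyPositive Φ)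
    {n : ℕ} (A : Fin n → Op 𝓗) (x : Fin n → 𝓗) :
    0 ≤ (∑ i, ∑ j, inner ℂ (x i) (Φ (star (A i) * A j) (x j))).re := by
  rcases n with - | n
  · simp
  have hM : 0 ≤ (CStarMatrix.ofMatrix fun i j => star (A i) * A j :
      CStarMatrix (Fin (n + 1)) (Fin (n + 1)) (Op 𝓗)) := by
    -- The factor is the square matrix with first row `A` and zeros elsewhere; it needs a row `0`,
    -- hence the separate case `n = 0`.
    refine CStarMatrix.nonneg_iff_exists_entries.2
      ⟨fun r i => if r = 0 then A i else 0, fun i j => ?_⟩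
    rw [Finset.sum_eq_single 0] <;> simp +contextual
    rfl
  obtain ⟨N, hN⟩ := CStarMatrix.nonneg_iff_exists_entries.1 (isCompletelyPositive_iff.1 hΦ _ _ hM)
  have hN' : ∀ i j, Φ (star (A i) * A j) = ∑ r, star (N r i) * N r j := hN
  have key : ∑ i, ∑ j, inner ℂ (x i) (Φ (star (A i) * A j) (x j)) =
      ∑ r, inner ℂ (∑ i, N r i (x i)) (∑ j, N r j (x j)) := by
    simp only [sum_inner, inner_sum]
    have h1 : ∀ i j, inner ℂ (x i) (Φ (star (A i) * A j) (x j)) =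
        ∑ r, inner ℂ (N r i (x i)) (N r j (x j)) := fun i j => by
      rw [hN', sum_apply, inner_sum]
      refine Finset.sum_congr rfl fun r _ => ?_
      exact ContinuousLinearMap.adjoint_inner_right (N r i) (x i) (N r j (x j))
    simp only [h1]
    calc _ = ∑ i, ∑ r, ∑ j, inner ℂ (N r i (x i)) (N r j (x j)) :=
          Finset.sum_congr rfl fun i _ => Finset.sum_comm
      _ = ∑ r, ∑ i, ∑ j, inner ℂ (N r i (x i)) (N r j (x j)) := Finset.sum_comm
      _ = _ := Finset.sum_congr rfl fun r _ => Finset.sum_comm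
  rw [key, Complex.re_sum]
  exact Finset.sum_nonneg fun r _ => inner_self_nonneg (𝕜 := ℂ)

theorem IsCompletelyPositive.map_star {Φ : SuperOp 𝓗} (hΦ : IsCompletelyPositive Φ) (A : Op 𝓗) :
    Φ (star A) = star (Φ A) := by
  obtain ⟨φ, hφ⟩ := hΦ
  rw [← hφ, ← hφ]
  exact StarHomClass.map_star φ A

end CompletelyPositive

/-! ### One-parameter semigroups and exponentials in Banach algebras. -/

section BanachAlgebra

open NormedSpace

variable {𝔸 : Type*} [NormedRing 𝔸] [NormedAlgebra ℝ 𝔸] [CompleteSpace 𝔸]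

/-- A norm continuous one-parameter semigroup in a Banach algebra is an exponential. -/
theorem exists_eq_exp_smul_of_semigroup {f : ℝ≥0 → 𝔸} (h0 : f 0 = 1)
    (hadd : ∀ t s, f (t + s) = f t * f s) (hf : Continuous f) :
    ∃ L : 𝔸, ∀ t : ℝ≥0, f t = exp ((t : ℝ) • L) := by
  -- `F` is continuous on the whole line, constantly `1` for negative times; the semigroup law is
  -- available only for nonnegative ones.
  set F : ℝ → 𝔸 := fun t => f t.toNNReal with hF
  have hFc : Continuous F := hf.comp continuous_real_toNNReal
  have hF0 : F 0 = 1 := by simp [hF, h0]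
  have hFadd : ∀ t s, 0 ≤ t → 0 ≤ s → F (t + s) = F t * F s := fun t s ht hs => by
    simp [hF, Real.toNNReal_add ht hs, hadd]
  set G : ℝ → 𝔸 := fun x => ∫ s in (0 : ℝ)..x, F s with hG
  have hGd : ∀ x, HasDerivAt G (F x) x := fun x =>
    intervalIntegral.integral_hasDerivAt_right (hFc.intervalIntegrable _ _)
      (hFc.stronglyMeasurableAtFilter _ _) hFc.continuousAt
  have hslope : Filter.Tendsto (fun a : ℝ => a⁻¹ • G a) (𝓝[>] 0) (𝓝 1) := by
    have := (hGd 0).tendsto_slope_zero_right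
    simpa [hG, hF0] using this
  -- The averages `a⁻¹ • G a` tend to `1` and units form an open set, so `G a` is invertible for
  -- some small `a > 0`.
  obtain ⟨a, hau, ha⟩ := ((hslope.eventually
    (Units.isOpen.mem_nhds (isUnit_one : IsUnit (1 : 𝔸)))).and self_mem_nhdsWithin).exists
  have ha : 0 < a := ha
  have hGa : IsUnit (G a) := by
    have : G a = algebraMap ℝ 𝔸 a * (a⁻¹ • G a) := by
      rw [Algebra.algebraMap_eq_smul_one, smul_one_mul, smul_smul, mul_inv_cancel₀ ha.ne', one_smul]
    rw [this]
    exact ((isUnit_iff_ne_zero.2 ha.ne').map (algebraMap ℝ 𝔸)).mul hau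
  obtain ⟨u, hu⟩ := hGa
  have hint : ∀ t, 0 ≤ t → F t * G a = G (t + a) - G t := by
    intro t ht
    have h1 : F t * G a = ∫ s in (0 : ℝ)..a, F (t + s) := by
      have h2 : ((ContinuousLinearMap.mul ℝ 𝔸) (F t)) (G a) = ∫ s in (0 : ℝ)..a, F t * F s :=
        (((ContinuousLinearMap.mul ℝ 𝔸) (F t)).intervalIntegral_comp_comm
          (hFc.intervalIntegrable _ _)).symm
      rw [ContinuousLinearMap.mul_apply'] at h2
      rw [h2]
      refine intervalIntegral.integral_congr fun s hs => ?_
      rw [Set.uIcc_of_le ha.le] at hs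
      exact (hFadd t s ht hs.1).symm
    rw [h1, intervalIntegral.integral_comp_add_left, hG]
    simp only [add_zero]
    rw [intervalIntegral.integral_interval_sub_left] <;> exact hFc.intervalIntegrable _ _
  have hFeq : ∀ t, 0 ≤ t → F t = (G (t + a) - G t) * (↑u⁻¹ : 𝔸) := fun t ht => by
    rw [← hint t ht, ← hu, mul_assoc, Units.mul_inv, mul_one]
  set L : 𝔸 := (F a - 1) * (↑u⁻¹ : 𝔸) with hL
  -- `U` agrees with `F` for `t ≥ 0` but is differentiable from both sides at `0`, which `F` need
  -- not be.
  set U : ℝ → 𝔸 := fun t => (G (t + a) - G t) * (↑u⁻¹ : 𝔸) with hU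
  have hUd : ∀ t, 0 ≤ t → HasDerivAt U (U t * L) t := by
    intro t ht
    have h1 : HasDerivAt U ((F (t + a) - F t) * (↑u⁻¹ : 𝔸)) t :=
      (((hGd (t + a)).comp_add_const t a).sub (hGd t)).mul_const _
    convert h1 using 1
    rw [show U t = F t from (hFeq t ht).symm, hFadd t a ht ha.le, hL]
    noncomm_ring
  refine ⟨L, fun t => ?_⟩
  have hW : ∀ s, 0 ≤ s → HasDerivAt (fun s => U s * exp (s • (-L))) 0 s := by
    intro s hs
    have h := (hUd s hs).mul (hasDerivAt_exp_smul_const' (-L) s)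
    have hz : U s * L * exp (s • -L) + U s * (-L * exp (s • -L)) = 0 := by noncomm_ring
    rwa [hz] at h
  have hconst := constant_of_has_deriv_right_zero (a := 0) (b := (t : ℝ))
    (f := fun s => U s * exp (s • (-L)))
    (fun s hs => (hW s hs.1).continuousAt.continuousWithinAt)
    (fun s hs => (hW s hs.1).hasDerivWithinAt) t ⟨t.2, le_rfl⟩
  have hft : f t = U t := by
    rw [show U t = F t from (hFeq t t.2).symm]; simp [hF]
  have hU0 : U 0 = 1 := by rw [← hF0]; exact (hFeq 0 le_rfl).symm
  simp only [hU0, zero_smul, exp_zero, mul_one] at hconst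
  calc f t = U t * (exp ((t : ℝ) • (-L)) * exp ((t : ℝ) • L)) := by
        let := NormedAlgebra.restrictScalars ℚ ℝ 𝔸
        rw [smul_neg, ← exp_add_of_commute (Commute.refl _).neg_left, neg_add_cancel, exp_zero,
          mul_one, hft]
    _ = exp ((t : ℝ) • L) := by rw [← mul_assoc, hconst, one_mul]

theorem tendsto_inv_smul_exp_smul_sub_one (L : 𝔸) :
    Filter.Tendsto (fun t : ℝ≥0 => (t : ℝ)⁻¹ • (exp ((t : ℝ) • L) - 1)) (𝓝[>] 0) (𝓝 L) := by
  have h := (hasDerivAt_exp_smul_const L (0 : ℝ)).tendsto_slope_zero_right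
  simp only [zero_add, zero_smul, exp_zero, one_mul] at h
  refine h.comp (tendsto_nhdsWithin_iff.2 ⟨?_, ?_⟩)
  · exact (NNReal.continuous_coe.tendsto' 0 0 rfl).mono_left nhdsWithin_le_nhds
  · filter_upwards [self_mem_nhdsWithin] with t ht using NNReal.coe_pos.2 ht

/-- Telescoping one factor at a time. Asking only `‖1‖ ≤ 1` keeps the zero space admissible, where
`‖1‖ = 0`. -/
theorem norm_pow_sub_pow_le {𝔸 : Type*} [NormedRing 𝔸] {x y : 𝔸} {b : ℝ} (hb : 1 ≤ b) (h1 : ‖(1 : 𝔸)‖ ≤ 1)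
    (hx : ‖x‖ ≤ b) (hy : ‖y‖ ≤ b) (n : ℕ) : ‖x ^ n - y ^ n‖ ≤ n * ‖x - y‖ * b ^ n := by
  induction n with
  | zero => simp
  | succ n ih =>
    have hyn : ‖y ^ n‖ ≤ b ^ n := by
      rcases n with - | n
      · simpa using h1
      · exact (norm_pow_le' y n.succ_pos).trans (pow_le_pow_left₀ (norm_nonneg _) hy _)
    have hbn : b ^ n ≤ b ^ (n + 1) := pow_le_pow_right₀ hb n.le_succ
    calc ‖x ^ (n + 1) - y ^ (n + 1)‖ = ‖(x ^ n - y ^ n) * x + y ^ n * (x - y)‖ := by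
          congr 1; rw [pow_succ, pow_succ]; noncomm_ring
      _ ≤ ‖x ^ n - y ^ n‖ * ‖x‖ + ‖y ^ n‖ * ‖x - y‖ :=
          (norm_add_le _ _).trans (add_le_add (norm_mul_le _ _) (norm_mul_le _ _))
      _ ≤ n * ‖x - y‖ * b ^ n * b + b ^ (n + 1) * ‖x - y‖ := by
          gcongr
          exact hyn.trans hbn
      _ = (n + 1 : ℕ) * ‖x - y‖ * b ^ (n + 1) := by push_cast; ring

/-- If `X n = 1 + L / n + o(1 / n)`, then `X n ^ n` converges to `exp L`. -/
theorem tendsto_pow_exp_of_tendsto (h1 : ‖(1 : 𝔸)‖ ≤ 1) {X : ℕ → 𝔸} {L : 𝔸}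
    (hX : Filter.Tendsto (fun n : ℕ => n • (X n - 1)) Filter.atTop (𝓝 L)) :
    Filter.Tendsto (fun n => X n ^ n) Filter.atTop (𝓝 (exp L)) := by
  simp only [← Nat.cast_smul_eq_nsmul ℝ] at hX
  -- `Y n` has the same first-order expansion as `X n`, and `Y n ^ n` is exactly `exp L`; it remains
  -- to compare `n`-th powers.
  set Y : ℕ → 𝔸 := fun n => exp ((n : ℝ)⁻¹ • L) with hY
  have hYt : Filter.Tendsto (fun n : ℕ => (n : ℝ) • (Y n - 1)) Filter.atTop (𝓝 L) := by
    have h := (hasDerivAt_exp_smul_const L (0 : ℝ)).tendsto_slope_zero_right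
    simp only [zero_add, zero_smul, exp_zero, one_mul] at h
    have h2 : Filter.Tendsto (fun n : ℕ => (n : ℝ)⁻¹) Filter.atTop (𝓝[>] 0) :=
      tendsto_inv_atTop_nhdsGT_zero.comp tendsto_natCast_atTop_atTop
    simpa [Function.comp_def, hY] using h.comp h2
  have hYpow : ∀ᶠ n in Filter.atTop, Y n ^ n = exp L := by
    filter_upwards [Filter.eventually_gt_atTop 0] with n hn
    let := NormedAlgebra.restrictScalars ℚ ℝ 𝔸
    rw [hY]
    simp only
    rw [← exp_nsmul, ← Nat.cast_smul_eq_nsmul ℝ, smul_smul, mul_inv_cancel₀ (by positivity),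
      one_smul]
  have hbound : ∀ {Z : ℕ → 𝔸},
      Filter.Tendsto (fun n : ℕ => (n : ℝ) • (Z n - 1)) Filter.atTop (𝓝 L) →
      ∀ᶠ n : ℕ in Filter.atTop, ‖Z n‖ ≤ 1 + (‖L‖ + 1) / n := by
    intro Z hZ
    filter_upwards [hZ.norm.eventually (gt_mem_nhds (lt_add_one ‖L‖)),
      Filter.eventually_gt_atTop 0] with n hn hn0
    have hn0' : (0 : ℝ) < n := Nat.cast_pos.2 hn0
    rw [norm_smul, Real.norm_natCast] at hn
    have : ‖Z n - 1‖ ≤ (‖L‖ + 1) / n := by rw [le_div_iff₀ hn0']; linarith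
    calc ‖Z n‖ = ‖1 + (Z n - 1)‖ := by rw [add_sub_cancel]
      _ ≤ ‖(1 : 𝔸)‖ + ‖Z n - 1‖ := norm_add_le _ _
      _ ≤ _ := add_le_add h1 this
  -- The factor `n` from telescoping is absorbed by `n • (X n - Y n) → 0`, while the powers of the
  -- norm bound stay below `exp (‖L‖ + 1)`.
  have hdiff : Filter.Tendsto (fun n => X n ^ n - Y n ^ n) Filter.atTop (𝓝 0) := by
    have hlim : Filter.Tendsto (fun n : ℕ => ‖(n : ℝ) • (X n - 1) - (n : ℝ) • (Y n - 1)‖ *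
        Real.exp (‖L‖ + 1)) Filter.atTop (𝓝 0) := by
      simpa using (hX.sub hYt).norm.mul_const (Real.exp (‖L‖ + 1))
    refine squeeze_zero_norm' ?_ hlim
    filter_upwards [hbound hX, hbound hYt, Filter.eventually_gt_atTop 0] with n hx hy hn0
    have hn0' : (0 : ℝ) < n := Nat.cast_pos.2 hn0
    have hc : 0 ≤ (‖L‖ + 1) / n := by positivity
    refine (norm_pow_sub_pow_le (by linarith) h1 hx hy n).trans ?_
    have he : (1 + (‖L‖ + 1) / n) ^ n ≤ Real.exp (‖L‖ + 1) := by
      calc (1 + (‖L‖ + 1) / n) ^ n ≤ Real.exp ((‖L‖ + 1) / n) ^ n := by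
            gcongr
            rw [add_comm]; exact Real.add_one_le_exp _
        _ = Real.exp (‖L‖ + 1) := by
            rw [← Real.exp_nat_mul, mul_div_cancel₀ _ hn0'.ne']
    rw [← smul_sub, sub_sub_sub_cancel_right, norm_smul, Real.norm_natCast]
    gcongr
  have := hdiff.add (tendsto_const_nhds.congr' (hYpow.mono fun n hn => hn.symm))
  simpa using this

theorem exp_add_smul (t s : ℝ) (L : 𝔸) : exp ((t + s) • L) = exp (t • L) * exp (s • L) := by
  let := NormedAlgebra.restrictScalars ℚ ℝ 𝔸
  rw [add_smul]
  exact exp_add_of_commute (((Commute.refl L).smul_left _).smul_right _)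

theorem continuous_exp_smul (L : 𝔸) : Continuous fun t : ℝ≥0 => exp ((t : ℝ) • L) := by
  let := NormedAlgebra.restrictScalars ℚ ℝ 𝔸
  exact exp_continuous.comp (NNReal.continuous_coe.smul continuous_const)

end BanachAlgebra

/-! ### Maps of GKSL form generate quantum dynamical semigroups. -/

section GKSLSemigroup

open NormedSpace

variable {𝓗 : Type*} [NormedAddCommGroup 𝓗] [InnerProductSpace ℂ 𝓗] [CompleteSpace 𝓗]

theorem SuperOp.real_smul_eq {𝓗 : Type*} [NormedAddCommGroup 𝓗] [InnerProductSpace ℂ 𝓗] (r : ℝ) (L : SuperOp 𝓗) : r • L = (r : ℂ) • L := rfl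

/-- If `L(A) = ∑ a, W a† A W a + K† A + A K`, then `exp (t L)` is completely positive. -/
theorem isCompletelyPositive_exp_smul {ι : Type*} [Fintype ι] {L : SuperOp 𝓗} (W : ι → Op 𝓗)
    (K : Op 𝓗) (hL : ∀ A, L A = ∑ a, star (W a) * A * W a + (star K * A + A * K)) (t : ℝ≥0) :
    IsCompletelyPositive (exp ((t : ℝ) • L)) := by
  rw [SuperOp.real_smul_eq]
  set R : SuperOp 𝓗 := ContinuousLinearMap.mulLeftRight ℂ (Op 𝓗) (star K) K with hR
  set h : ℕ → ℝ := fun n => t / n with hh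
  have hh0 : ∀ n, 0 ≤ h n := fun n => by positivity
  -- The term in `R` completes the product: `X n` sends `A` to `(1 + h K)† A (1 + h K) + h ∑ W a† A
  -- W a`, a Kraus sum, and the correction disappears in the limit of `n • (X n - 1)`.
  set X : ℕ → SuperOp 𝓗 := fun n => 1 + (h n : ℂ) • L + (h n : ℂ) ^ 2 • R with hX
  have hXcp : ∀ n, IsCompletelyPositive (X n) := by
    intro n
    refine IsCompletelyPositive.of_kraus (ι := Option ι)
      (fun o => o.elim (1 + (h n : ℂ) • K) fun a => (√(h n) : ℂ) • W a) fun A => ?_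
    have hs : ∀ a, star ((√(h n) : ℂ) • W a) * A * ((√(h n) : ℂ) • W a) =
        (h n : ℂ) • (star (W a) * A * W a) := fun a => by
      rw [star_smul, smul_mul_assoc, smul_mul_smul_comm, Complex.star_def, Complex.conj_ofReal,
        ← Complex.ofReal_mul, Real.mul_self_sqrt (hh0 n)]
    simp only [Fintype.sum_option, Option.elim, hs, ← Finset.smul_sum]
    have hXA : X n A = A + (h n : ℂ) • L A + (h n : ℂ) ^ 2 • (star K * A * K) := by
      simp [hX, hR]
    rw [hXA, hL, star_add, star_smul, star_one, Complex.star_def, Complex.conj_ofReal]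
    simp only [add_mul, mul_add, smul_add, one_mul, mul_one, smul_mul_assoc, mul_smul_comm,
      smul_smul, pow_two]
    abel
  have h1 : ‖(1 : SuperOp 𝓗)‖ ≤ 1 := ContinuousLinearMap.norm_id_le
  have hlim : Filter.Tendsto (fun n : ℕ => n • (X n - 1)) Filter.atTop
      (𝓝 (((t : ℝ) : ℂ) • L)) := by
    have h2 : Filter.Tendsto (fun n : ℕ => ((t : ℝ) : ℂ) • L +
        (((t : ℝ) : ℂ) ^ 2 * (n : ℂ)⁻¹) • R) Filter.atTop (𝓝 (((t : ℝ) : ℂ) • L)) := by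
      have := ((tendsto_inv_atTop_nhds_zero_nat (𝕜 := ℂ)).const_mul (((t : ℝ) : ℂ) ^ 2)).smul_const R
      simpa [show (0 : ℂ) • R = 0 from zero_smul ℂ R] using this.const_add (((t : ℝ) : ℂ) • L)
    refine h2.congr' ?_
    filter_upwards [Filter.eventually_gt_atTop 0] with n hn
    have hn' : (n : ℂ) ≠ 0 := Nat.cast_ne_zero.2 hn.ne'
    rw [hX, ← Nat.cast_smul_eq_nsmul ℂ]
    simp only [hh]
    rw [add_assoc, add_sub_cancel_left, smul_add, smul_smul, smul_smul]
    congr 2 <;> · push_cast; field_simp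
  exact isClosed_setOf_isCompletelyPositive.mem_of_tendsto (tendsto_pow_exp_of_tendsto h1 hlim)
    (Filter.Eventually.of_forall fun n => (hXcp n).pow n)

theorem exp_apply_of_apply_eq_zero {E : Type*} [NormedAddCommGroup E] [NormedSpace ℂ E]
    [CompleteSpace E] {L : E →L[ℂ] E} {v : E} (h : L v = 0) : exp L v = v := by
  have hs := (exp_series_hasSum_exp' (𝕂 := ℂ) L).mapL (ContinuousLinearMap.apply ℂ E v)
  have h0 := hasSum_single (f := fun n : ℕ =>
    ContinuousLinearMap.apply ℂ E v ((n.factorial⁻¹ : ℂ) • L ^ n)) 0 fun n hn => by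
      obtain ⟨m, rfl⟩ := Nat.exists_eq_succ_of_ne_zero hn
      simp [pow_succ, h]
  simpa using hs.unique h0

theorem HasGKSLForm.map_one {L : SuperOp 𝓗} {N : ℕ} {H : Op 𝓗} {V : Fin N → Op 𝓗}
    (h : HasGKSLForm L H V) : L 1 = 0 := by
  rw [h 1]
  simp only [mul_one, one_mul, sub_self, smul_zero, zero_add]
  refine Finset.sum_eq_zero fun j _ => ?_
  rw [← two_smul ℂ, smul_smul]
  norm_num

theorem HasGKSLForm.isQDS {L : SuperOp 𝓗} {N : ℕ} {H : Op 𝓗} {V : Fin N → Op 𝓗}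
    (hH : IsSelfAdjoint H) (h : HasGKSLForm L H V) :
    IsQDS (fun t : ℝ≥0 => exp ((t : ℝ) • L)) where
  map_zero := (congrArg exp (zero_smul ℝ L)).trans exp_zero
  map_add t s := exp_add_smul (t : ℝ) (s : ℝ) L
  continuous := continuous_exp_smul L
  completelyPositive t := by
    -- With `K = -iH - ½ ∑ V j† V j`, the term `K† A + A K` is the commutator together with the
    -- anticommutator part.
    refine isCompletelyPositive_exp_smul V
      (-(Complex.I • H) - (1 / 2 : ℂ) • ∑ j, star (V j) * V j) (fun A => ?_) t
    have hS : star (∑ j, star (V j) * V j) = ∑ j, star (V j) * V j := by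
      simp [star_sum]
    have hI : star (Complex.I • H) = -(Complex.I • H) := by
      rw [star_smul, hH.star_eq]; simp
    have h2 : star ((1 / 2 : ℂ) • ∑ j, star (V j) * V j) = (1 / 2 : ℂ) • ∑ j, star (V j) * V j := by
      rw [star_smul, hS]; simp
    rw [h A, star_sub, star_neg, hI, h2]
    simp only [Finset.sum_sub_distrib, ← Finset.smul_sum, Finset.sum_add_distrib, ← Finset.sum_mul,
      ← Finset.mul_sum]
    simp only [sub_mul, mul_sub, mul_neg, smul_mul_assoc, mul_smul_comm, smul_add,
      smul_sub, neg_neg]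
    abel
  unital t := exp_apply_of_apply_eq_zero (by simp [SuperOp.real_smul_eq, h.map_one])

end GKSLSemigroup

/-! ### Conditional complete positivity of the generator. -/

section Generator

open InnerProductSpace

variable {𝓗 : Type*} [NormedAddCommGroup 𝓗] [InnerProductSpace ℂ 𝓗]

/-- The quadratic form `∑ i j, ⟪x i, Φ (A i† A j) x j⟫`, whose positivity for all `A` and `x`
characterizes complete positivity of `Φ`. -/
noncomputable def cpForm [CompleteSpace 𝓗] {n : ℕ} (A : Fin n → Op 𝓗) (x : Fin n → 𝓗)
    (Φ : SuperOp 𝓗) : ℂ :=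
  ∑ i, ∑ j, inner ℂ (x i) (Φ (star (A i) * A j) (x j))

theorem IsGenerator.tendsto_apply {Λ : ℝ≥0 → SuperOp 𝓗} {L : SuperOp 𝓗} (h : IsGenerator Λ L)
    (A : Op 𝓗) : Filter.Tendsto (fun t : ℝ≥0 => (t : ℝ)⁻¹ • (Λ t A - A)) (𝓝[>] 0) (𝓝 (L A)) :=
  ((ContinuousLinearMap.apply ℂ (Op 𝓗) A).continuous.tendsto L).comp h

variable [CompleteSpace 𝓗]

/-- This is why the constraint `∑ A i (x i) = 0` appears: it kills the identity in `(Λ t - 1) / t`.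
-/
theorem cpForm_one {n : ℕ} (A : Fin n → Op 𝓗) (x : Fin n → 𝓗) :
    cpForm A x 1 = inner ℂ (∑ i, A i (x i)) (∑ j, A j (x j)) := by
  simp only [cpForm, sum_inner, inner_sum]
  rw [Finset.sum_comm]
  refine Finset.sum_congr rfl fun i _ => Finset.sum_congr rfl fun j _ => ?_
  exact ContinuousLinearMap.adjoint_inner_right (A j) (x j) (A i (x i))

theorem IsQDS.generator_map_one {Λ : ℝ≥0 → SuperOp 𝓗} {L : SuperOp 𝓗} (hΛ : IsQDS Λ)
    (h : IsGenerator Λ L) : L 1 = 0 := by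
  refine tendsto_nhds_unique (h.tendsto_apply 1) ?_
  simp [hΛ.unital]

theorem IsQDS.generator_map_star {Λ : ℝ≥0 → SuperOp 𝓗} {L : SuperOp 𝓗} (hΛ : IsQDS Λ)
    (h : IsGenerator Λ L) (A : Op 𝓗) : L (star A) = star (L A) := by
  refine tendsto_nhds_unique (h.tendsto_apply (star A)) ((h.tendsto_apply A).star.congr fun t => ?_)
  rw [star_smul, star_trivial, star_sub, (hΛ.completelyPositive t).map_star]

/-- Generators of quantum dynamical semigroups are conditionally completely positive. -/
theorem IsQDS.generator_cpForm_nonneg {Λ : ℝ≥0 → SuperOp 𝓗} {L : SuperOp 𝓗} (hΛ : IsQDS Λ)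
    (h : IsGenerator Λ L) {n : ℕ} (A : Fin n → Op 𝓗) (x : Fin n → 𝓗)
    (hx : ∑ i, A i (x i) = 0) : 0 ≤ (cpForm A x L).re := by
  have hcont : Continuous fun Φ : SuperOp 𝓗 => (cpForm A x Φ).re := by
    refine Complex.continuous_re.comp (continuous_finsetSum _ fun i _ =>
      continuous_finsetSum _ fun j _ => continuous_const.inner ?_)
    exact ((ContinuousLinearMap.apply ℂ 𝓗 (x j)).comp
      (ContinuousLinearMap.apply ℂ (Op 𝓗) (star (A i) * A j))).continuous
  refine ge_of_tendsto ((hcont.tendsto L).comp h) (Filter.Eventually.of_forall fun t => ?_)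
  have hlin : cpForm A x ((t : ℝ)⁻¹ • (Λ t - 1)) =
      ((t : ℝ)⁻¹ : ℝ) • (cpForm A x (Λ t) - cpForm A x 1) := by
    simp only [cpForm, Finset.smul_sum, ← Finset.sum_sub_distrib]
    refine Finset.sum_congr rfl fun i _ => Finset.sum_congr rfl fun j _ => ?_
    rw [← inner_sub_right, ← inner_smul_right_eq_smul]
    rfl
  simp only [Function.comp_apply]
  rw [hlin, cpForm_one, hx, inner_zero_left, sub_zero, Complex.smul_re]
  exact mul_nonneg (by positivity) ((hΛ.completelyPositive t).re_sum_inner_nonneg A x)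

/-- A conditionally completely positive map becomes completely positive after subtracting a map
of the form `A ↦ K† A + A K`. -/
theorem exists_cpForm_sub_nonneg [Nontrivial 𝓗] {L : SuperOp 𝓗}
    (hstar : ∀ A, L (star A) = star (L A))
    (hL : ∀ {n : ℕ} (A : Fin n → Op 𝓗) (x : Fin n → 𝓗), ∑ i, A i (x i) = 0 →
      0 ≤ (cpForm A x L).re) :
    ∃ (Ψ : SuperOp 𝓗) (K : Op 𝓗), (∀ A, L A = Ψ A + (star K * A + A * K)) ∧
      ∀ {n : ℕ} (A : Fin n → Op 𝓗) (x : Fin n → 𝓗), 0 ≤ (cpForm A x Ψ).re := by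
  obtain ⟨e, he⟩ := exists_norm_eq 𝓗 zero_le_one
  set T : Op 𝓗 := ((ContinuousLinearMap.apply ℂ 𝓗 e).comp L).comp ((rankOne ℂ).flip e) with hT
  have hTx : ∀ x, T x = L (rankOne ℂ x e) e := fun x => rfl
  set c : ℝ := (inner ℂ e (T e)).re with hc
  -- The shift by `c / 2` is chosen so that `K` and its adjoint together account for the term `‖v‖ ^
  -- 2 * c` of the extended form below.
  set K : Op 𝓗 := T - ((c / 2 : ℝ) : ℂ) • 1 with hK
  set Ψ : SuperOp 𝓗 := L - (ContinuousLinearMap.mul ℂ (Op 𝓗) K +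
    (ContinuousLinearMap.mul ℂ (Op 𝓗)).flip (star K)) with hΨ
  have hΨA : ∀ A, Ψ A = L A - (K * A + A * star K) := fun A => rfl
  refine ⟨Ψ, star K, fun A => by rw [hΨA, star_star, sub_add_cancel], fun {n} A x => ?_⟩
  obtain ⟨v, hv⟩ : ∃ v, v = ∑ i, A i (x i) := ⟨_, rfl⟩
  -- The extra operator sends the unit vector `e` to `-v`, which enforces the constraint. The
  -- extended form of `L` then has real part `cpForm A x L - 2 Re S + c ‖v‖ ^ 2`, which is that of
  -- `cpForm A x Ψ`.
  have hcond := hL (Fin.cons (-rankOne ℂ v e) A) (Fin.cons e x : Fin (n + 1) → 𝓗) (by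
    rw [Fin.sum_univ_succ]
    simp [he, hv])
  have hstarR : star (-rankOne ℂ v e) = -rankOne ℂ e v := by
    rw [star_neg, ContinuousLinearMap.star_eq_adjoint, adjoint_rankOne]
  have hmulR : ∀ i, star (A i) * -rankOne ℂ v e = -rankOne ℂ (star (A i) v) e := fun i => by
    rw [mul_neg]; exact congrArg Neg.neg (comp_rankOne _ _ _)
  have hadj : ∀ (B : Op 𝓗) (y z : 𝓗), inner ℂ y (star B z) = inner ℂ (B y) z :=
    fun B y z => ContinuousLinearMap.adjoint_inner_right B y z
  set S : ℂ := ∑ i, inner ℂ (x i) (T (star (A i) v)) with hS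
  have hS' : ∑ i, inner ℂ (x i) (L (star (A i) * -rankOne ℂ v e) e) = -S := by
    rw [hS, ← Finset.sum_neg_distrib]
    refine Finset.sum_congr rfl fun i _ => ?_
    rw [hmulR, map_neg, hTx, neg_apply, inner_neg_right]
  have hSc : ∑ i, inner ℂ e (L (star (-rankOne ℂ v e) * A i) (x i)) = -(starRingEnd ℂ) S := by
    rw [← map_neg (starRingEnd ℂ) S, ← hS', map_sum]
    refine Finset.sum_congr rfl fun i _ => ?_
    rw [show star (-rankOne ℂ v e) * A i = star (star (A i) * -rankOne ℂ v e) by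
      rw [star_mul, star_star], hstar, inner_conj_symm, hadj]
  have hvv : inner ℂ v v = ((‖v‖ ^ 2 : ℝ) : ℂ) := by
    rw [inner_self_eq_norm_sq_to_K]
    simp
  have h00 : (inner ℂ e (L (star (-rankOne ℂ v e) * -rankOne ℂ v e) e)).re = ‖v‖ ^ 2 * c := by
    have : star (-rankOne ℂ v e) * -rankOne ℂ v e = ((‖v‖ ^ 2 : ℝ) : ℂ) • rankOne ℂ e e := by
      rw [hstarR, neg_mul_neg]
      refine (rankOne_comp_rankOne _ _ _ _).trans ?_
      rw [hvv]
    rw [this, map_smul, smul_apply, inner_smul_right, Complex.re_ofReal_mul, ← hTx]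
  have hexp : cpForm (Fin.cons (-rankOne ℂ v e) A) (Fin.cons e x : Fin (n + 1) → 𝓗) L =
      inner ℂ e (L (star (-rankOne ℂ v e) * -rankOne ℂ v e) e) - (starRingEnd ℂ) S +
        (-S + cpForm A x L) := by
    rw [cpForm, Fin.sum_univ_succ]
    simp only [Fin.sum_univ_succ, Fin.cons_zero, Fin.cons_succ, hSc, Finset.sum_add_distrib, hS']
    rw [cpForm, sub_eq_add_neg]
  have hKS : ∑ i, ∑ j, inner ℂ (x i) (K (star (A i) (A j (x j)))) = S - (‖v‖ ^ 2 * c / 2 : ℝ) := by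
    have h1 : ∀ i, ∑ j, inner ℂ (x i) (K (star (A i) (A j (x j)))) =
        inner ℂ (x i) (T (star (A i) v)) - ((c / 2 : ℝ) : ℂ) * inner ℂ (A i (x i)) v := fun i => by
      rw [← inner_sum, ← map_sum, ← map_sum, ← hv, ← hadj, ← inner_smul_right, ← inner_sub_right]
      rfl
    rw [Finset.sum_congr rfl fun i _ => h1 i, Finset.sum_sub_distrib, ← Finset.mul_sum,
      ← sum_inner, ← hv, hvv, ← hS]
    push_cast
    ring
  have hKS' : ∑ i, ∑ j, inner ℂ (x i) (star (A i) (A j (star K (x j)))) =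
      (starRingEnd ℂ) (S - (‖v‖ ^ 2 * c / 2 : ℝ)) := by
    rw [← hKS, map_sum, Finset.sum_comm]
    refine Finset.sum_congr rfl fun j _ => ?_
    rw [map_sum]
    refine Finset.sum_congr rfl fun i _ => ?_
    rw [inner_conj_symm, hadj, ← hadj K, ← hadj (star (A j)), star_star]
  have htarget : cpForm A x Ψ = cpForm A x L - ((S - (‖v‖ ^ 2 * c / 2 : ℝ)) +
      (starRingEnd ℂ) (S - (‖v‖ ^ 2 * c / 2 : ℝ))) := by
    rw [← hKS', ← hKS]
    simp only [cpForm, ← Finset.sum_add_distrib, ← Finset.sum_sub_distrib]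
    refine Finset.sum_congr rfl fun i _ => Finset.sum_congr rfl fun j _ => ?_
    rw [← inner_add_right, ← inner_sub_right]
    rfl
  rw [hexp] at hcond
  rw [htarget]
  simp only [Complex.add_re, Complex.sub_re, Complex.neg_re, Complex.conj_re, h00,
    Complex.ofReal_re] at hcond ⊢
  linarith

end Generator

/-! ### Choi matrices and Kraus decompositions. -/

section Kraus

open InnerProductSpace
open scoped ComplexOrder

variable {𝓗 : Type*} [NormedAddCommGroup 𝓗] [InnerProductSpace ℂ 𝓗] [CompleteSpace 𝓗]

theorem Matrix.PosSemidef.exists_eq_sum_star_mul {n : Type*} [Fintype n] [DecidableEq n]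
    {C : Matrix n n ℂ} (hC : C.PosSemidef) :
    ∃ B : n → n → ℂ, ∀ i j, C i j = ∑ r, star (B r i) * B r j := by
  open scoped MatrixOrder Matrix.Norms.L2Operator in
  obtain ⟨B, rfl⟩ := CStarAlgebra.nonneg_iff_eq_star_mul_self.mp hC.nonneg
  exact ⟨B, fun i j => rfl⟩

/-- A Kraus sum depends on its coefficients `Q` only through the Gram matrix `Q† Q`, so families
with equal Gram matrices are interchangeable. -/
theorem sum_star_sum_smul_mul {κ ν R : Type*} [Fintype κ] [Fintype ν] [Ring R] [StarRing R]
    [Algebra ℂ R] [StarModule ℂ R] (Q : κ → ν → ℂ) (F : ν → R) (A : R) :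
    ∑ a, star (∑ p, Q a p • F p) * A * ∑ q, Q a q • F q =
      ∑ p, ∑ q, (∑ a, star (Q a p) * Q a q) • (star (F p) * A * F q) := by
  have hterm : ∀ a, star (∑ p, Q a p • F p) * A * ∑ q, Q a q • F q =
      ∑ p, ∑ q, (star (Q a p) * Q a q) • (star (F p) * A * F q) := fun a => by
    rw [star_sum, Finset.sum_mul, Finset.sum_mul_sum]
    refine Finset.sum_congr rfl fun p _ => Finset.sum_congr rfl fun q _ => ?_
    rw [star_smul, smul_mul_assoc, smul_mul_smul_comm]
  rw [Finset.sum_congr rfl fun a _ => hterm a, Finset.sum_comm]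
  refine Finset.sum_congr rfl fun p _ => ?_
  rw [Finset.sum_comm]
  exact Finset.sum_congr rfl fun q _ => (Finset.sum_smul).symm

/-- A sum `∑ j, V j† A V j` with all `V j` in an `m`-dimensional subspace can be rewritten as such
a sum with `m` terms. -/
theorem exists_kraus_of_finrank_eq {U : Submodule ℂ (Op 𝓗)} [FiniteDimensional ℂ U] {m : ℕ}
    (hm : Module.finrank ℂ U = m) {ι : Type*} [Fintype ι] (V : ι → Op 𝓗) (hV : ∀ a, V a ∈ U) :
    ∃ W : Fin m → Op 𝓗, (∀ r, W r ∈ U) ∧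
      ∀ A, ∑ a, star (V a) * A * V a = ∑ r, star (W r) * A * W r := by
  let F := Module.finBasisOfFinrankEq ℂ U hm
  let M : ι → Fin m → ℂ := fun a p => F.repr ⟨V a, hV a⟩ p
  have hVM : ∀ a, V a = ∑ p, M a p • (F p : Op 𝓗) := fun a => by
    have := congrArg U.subtype (F.sum_repr ⟨V a, hV a⟩)
    rw [map_sum] at this
    exact this.symm
  -- The Gram matrix of `M` is `m × m` whatever the size of `ι`, so it has a square factor `B`,
  -- whose rows give only `m` operators.
  obtain ⟨B, hB⟩ := (Matrix.posSemidef_conjTranspose_mul_self (Matrix.of M)).exists_eq_sum_star_mul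
  refine ⟨fun r => ∑ p, B r p • (F p : Op 𝓗),
    fun r => U.sum_mem fun p _ => U.smul_mem _ (F p).2, fun A => ?_⟩
  simp only [hVM]
  rw [sum_star_sum_smul_mul, sum_star_sum_smul_mul]
  refine Finset.sum_congr rfl fun p _ => Finset.sum_congr rfl fun q _ => ?_
  rw [← hB p q]
  rfl

theorem OrthonormalBasis.sum_inner_smul_rankOne {𝓗 : Type*} [NormedAddCommGroup 𝓗]
    [InnerProductSpace ℂ 𝓗] {n : Type*} [Fintype n]
    (b : OrthonormalBasis n ℂ 𝓗) (A : Op 𝓗) :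
    A = ∑ i, ∑ j, inner ℂ (b i) (A (b j)) • rankOne ℂ (b i) (b j) := by
  refine ContinuousLinearMap.ext fun x => ?_
  conv_lhs => rw [← b.sum_repr' x]
  simp only [sum_apply, smul_apply, rankOne_apply, map_sum, map_smul]
  rw [Finset.sum_comm]
  refine Finset.sum_congr rfl fun j _ => ?_
  conv_lhs => rw [← b.sum_repr' (A (b j)), Finset.smul_sum]
  exact Finset.sum_congr rfl fun i _ => smul_comm _ _ _

/-- Choi's theorem: a completely positive map has a Kraus decomposition. -/
theorem exists_kraus_of_cpForm_nonneg [FiniteDimensional ℂ 𝓗] [Nontrivial 𝓗] {Ψ : SuperOp 𝓗}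
    (hstar : ∀ A, Ψ (star A) = star (Ψ A))
    (hΨ : ∀ {n : ℕ} (A : Fin n → Op 𝓗) (x : Fin n → 𝓗), 0 ≤ (cpForm A x Ψ).re) :
    ∃ (d : ℕ) (W : Fin d × Fin d → Op 𝓗), ∀ A, Ψ A = ∑ r, star (W r) * A * W r := by
  obtain ⟨e, he⟩ := exists_norm_eq 𝓗 zero_le_one
  let d := Module.finrank ℂ 𝓗
  let b : OrthonormalBasis (Fin d) ℂ 𝓗 := stdOrthonormalBasis ℂ 𝓗
  -- The Choi matrix of `Ψ` in the basis `b`.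
  let C : Matrix (Fin d × Fin d) (Fin d × Fin d) ℂ :=
    fun p q => inner ℂ (b p.2) (Ψ (rankOne ℂ (b p.1) (b q.1)) (b q.2))
  have hadj : ∀ (B : Op 𝓗) (y z : 𝓗), inner ℂ y (star B z) = inner ℂ (B y) z :=
    fun B y z => ContinuousLinearMap.adjoint_inner_right B y z
  have hCH : C.IsHermitian := by
    refine Matrix.IsHermitian.ext fun p q => ?_
    simp only [C]
    rw [← starRingEnd_apply, inner_conj_symm, ← hadj, ← hstar,
      ContinuousLinearMap.star_eq_adjoint, adjoint_rankOne]
  have hC : C.PosSemidef := by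
    refine Matrix.PosSemidef.of_dotProduct_mulVec_nonneg hCH fun z => ?_
    -- With `A i = |e⟩⟨b i|`, the products `A i† A j` are the matrix units, so the Choi form is a
    -- value of `cpForm`.
    have hz : star z ⬝ᵥ C.mulVec z =
        cpForm (fun i => rankOne ℂ e (b i)) (fun i => ∑ k, z (i, k) • b k) Ψ := by
      have hmul : ∀ i j, star (rankOne ℂ e (b i)) * rankOne ℂ e (b j) =
          rankOne ℂ (b i) (b j) := fun i j => by
        rw [ContinuousLinearMap.star_eq_adjoint, adjoint_rankOne]
        refine (rankOne_comp_rankOne _ _ _ _).trans ?_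
        simp [inner_self_eq_norm_sq_to_K, he]
      simp only [cpForm, hmul, map_sum, map_smul, sum_inner, inner_sum, inner_smul_left,
        inner_smul_right, dotProduct, Matrix.mulVec, Fintype.sum_prod_type, Finset.mul_sum]
      refine Finset.sum_congr rfl fun i _ => ?_
      rw [Finset.sum_comm]
      refine Finset.sum_congr rfl fun j _ => ?_
      rw [Finset.sum_comm]
      refine Finset.sum_congr rfl fun k _ => Finset.sum_congr rfl fun l _ => ?_
      simp only [C, Pi.star_apply, Complex.star_def]
      ring
    rw [Complex.le_def]
    refine ⟨?_, (hCH.im_star_dotProduct_mulVec_self z).symm⟩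
    rw [hz]
    exact hΨ _ _
  obtain ⟨B, hB⟩ := hC.exists_eq_sum_star_mul
  -- Each row of the factor of the Choi matrix, reshaped into an operator, is a Kraus operator.
  refine ⟨d, fun r => ∑ j, ∑ l, B r (j, l) • rankOne ℂ (b j) (b l), fun A => ?_⟩
  have hWb : ∀ r l, (∑ j, ∑ l, B r (j, l) • rankOne ℂ (b j) (b l)) (b l) =
      ∑ j, B r (j, l) • b j := fun r l => by
    simp only [sum_apply, smul_apply, rankOne_apply, b.inner_eq_ite, ite_smul, one_smul, zero_smul,
      smul_ite, smul_zero, Finset.sum_ite_eq', Finset.mem_univ, if_true]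
  have hext : ∀ X Y : Op 𝓗, (∀ k l, inner ℂ (b k) (X (b l)) = inner ℂ (b k) (Y (b l))) → X = Y :=
    fun X Y hXY => by
      rw [b.sum_inner_smul_rankOne X, b.sum_inner_smul_rankOne Y]
      simp only [hXY]
  refine hext _ _ fun k l => ?_
  have hl : inner ℂ (b k) (Ψ A (b l)) = ∑ i, ∑ j, inner ℂ (b i) (A (b j)) * C (i, k) (j, l) := by
    conv_lhs => rw [b.sum_inner_smul_rankOne A]
    simp only [map_sum, map_smul, sum_apply, smul_apply, inner_sum, inner_smul_right, C]
  rw [hl, sum_apply, inner_sum]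
  have hr : ∀ r, inner ℂ (b k) ((star (∑ j, ∑ l, B r (j, l) • rankOne ℂ (b j) (b l)) * A *
      (∑ j, ∑ l, B r (j, l) • rankOne ℂ (b j) (b l))) (b l)) =
      ∑ i, ∑ j, inner ℂ (b i) (A (b j)) * (star (B r (i, k)) * B r (j, l)) := fun r => by
    have h1 := hadj (∑ j, ∑ l, B r (j, l) • rankOne ℂ (b j) (b l)) (b k)
      (A ((∑ j, ∑ l, B r (j, l) • rankOne ℂ (b j) (b l)) (b l)))
    refine h1.trans ?_
    rw [hWb, hWb, map_sum, sum_inner]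
    refine Finset.sum_congr rfl fun i _ => ?_
    rw [inner_sum]
    refine Finset.sum_congr rfl fun j _ => ?_
    rw [map_smul, inner_smul_left, inner_smul_right, starRingEnd_apply]
    ring
  refine Eq.trans ?_ (Finset.sum_congr rfl fun r _ => hr r).symm
  refine Eq.trans (Finset.sum_congr rfl fun i _ => ?_) Finset.sum_comm
  refine Eq.trans (Finset.sum_congr rfl fun j _ => ?_) Finset.sum_comm
  rw [hB, Finset.mul_sum]

end Kraus

/-! ### Traceless normal form and the bound on the number of operators. -/

section GKSLForm

variable {𝓗 : Type*} [NormedAddCommGroup 𝓗] [InnerProductSpace ℂ 𝓗]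

/-- The trace, as a linear functional on `L(𝓗)`. -/
noncomputable def opTrace (𝓗 : Type*) [NormedAddCommGroup 𝓗] [InnerProductSpace ℂ 𝓗] :
    Op 𝓗 →ₗ[ℂ] ℂ :=
  LinearMap.trace ℂ 𝓗 ∘ₗ ContinuousLinearMap.coeLM ℂ

theorem isTraceless_iff {A : Op 𝓗} : IsTraceless A ↔ opTrace 𝓗 A = 0 := Iff.rfl

section

variable [CompleteSpace 𝓗]

/-- Padding by a zero operator secures `N ≥ 1` when no bound on `N` is required. -/
theorem HasGKSLForm.cons_zero {L : SuperOp 𝓗} {N : ℕ} {H : Op 𝓗} {V : Fin N → Op 𝓗}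
    (h : HasGKSLForm L H V) : HasGKSLForm L H (Fin.cons 0 V : Fin (N + 1) → Op 𝓗) := fun A => by
  rw [h A, Fin.sum_univ_succ]
  simp

/-- Quantum dynamical semigroups are generated by the limit of their difference quotients. -/
theorem IsQDS.exists_generator {Λ : ℝ≥0 → SuperOp 𝓗} (hΛ : IsQDS Λ) :
    ∃ L : SuperOp 𝓗, IsGenerator Λ L ∧ ∀ t : ℝ≥0, Λ t = NormedSpace.exp ((t : ℝ) • L) := by
  obtain ⟨L, hL⟩ := exists_eq_exp_smul_of_semigroup hΛ.map_zero hΛ.map_add hΛ.continuous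
  refine ⟨L, ?_, hL⟩
  rw [IsGenerator, show Λ = fun t : ℝ≥0 => NormedSpace.exp ((t : ℝ) • L) from funext hL]
  exact tendsto_inv_smul_exp_smul_sub_one L

theorem HasGKSLForm.of_subsingleton [Subsingleton 𝓗] (L : SuperOp 𝓗) (H : Op 𝓗) {N : ℕ}
    (V : Fin N → Op 𝓗) : HasGKSLForm L H V := fun _ => Subsingleton.elim _ _

end

variable [FiniteDimensional ℂ 𝓗]

theorem opTrace_one : opTrace 𝓗 1 = Module.finrank ℂ 𝓗 := LinearMap.trace_one ℂ 𝓗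

theorem opTrace_star [CompleteSpace 𝓗] (A : Op 𝓗) : opTrace 𝓗 (star A) = star (opTrace 𝓗 A) := by
  have h : ∀ B : Op 𝓗, opTrace 𝓗 B =
      ∑ i, inner ℂ (stdOrthonormalBasis ℂ 𝓗 i) (B (stdOrthonormalBasis ℂ 𝓗 i)) :=
    fun B => LinearMap.trace_eq_sum_inner (B : 𝓗 →ₗ[ℂ] 𝓗) (stdOrthonormalBasis ℂ 𝓗)
  rw [h, h, star_sum]
  refine Finset.sum_congr rfl fun i _ => ?_
  rw [← starRingEnd_apply, inner_conj_symm]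
  exact ContinuousLinearMap.adjoint_inner_right A _ _

/-- Every operator becomes traceless after subtracting a multiple of the identity. -/
theorem isTraceless_sub_smul_one [Nontrivial 𝓗] (A : Op 𝓗) :
    IsTraceless (A - (opTrace 𝓗 A / Module.finrank ℂ 𝓗) • 1) := by
  have hd : (Module.finrank ℂ 𝓗 : ℂ) ≠ 0 := Nat.cast_ne_zero.2 Module.finrank_pos.ne'
  rw [isTraceless_iff, map_sub, map_smul, opTrace_one, smul_eq_mul, div_mul_cancel₀ _ hd, sub_self]

theorem finrank_op : Module.finrank ℂ (Op 𝓗) = Module.finrank ℂ 𝓗 ^ 2 := by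
  rw [← (LinearMap.toContinuousLinearMap (𝕜 := ℂ) (E := 𝓗) (F' := 𝓗)).finrank_eq,
    Module.finrank_linearMap, pow_two]

/-- The origin of the bound `d ^ 2 - 1`: the trace is a nonzero functional, so its kernel has
codimension one. -/
theorem finrank_ker_opTrace [Nontrivial 𝓗] :
    Module.finrank ℂ (LinearMap.ker (opTrace 𝓗)) = Module.finrank ℂ 𝓗 ^ 2 - 1 := by
  have hne : opTrace 𝓗 ≠ 0 := fun h => by
    have h1 := opTrace_one (𝓗 := 𝓗)
    rw [h, LinearMap.zero_apply] at h1
    exact Nat.cast_ne_zero.2 (Module.finrank_pos (R := ℂ) (M := 𝓗)).ne' h1.symm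
  have h2 := (opTrace 𝓗).finrank_range_add_finrank_ker
  rw [LinearMap.range_eq_top.2 (LinearMap.surjective hne), finrank_top, Module.finrank_self,
    finrank_op] at h2
  omega

variable [CompleteSpace 𝓗]

/-- Kraus operators can be made traceless at the cost of changing the drift term. -/
theorem exists_isTraceless_kraus [Nontrivial 𝓗] {ι : Type*} [Fintype ι] {L : SuperOp 𝓗}
    (W : ι → Op 𝓗) (K : Op 𝓗)
    (hL : ∀ A, L A = ∑ a, star (W a) * A * W a + (star K * A + A * K)) :
    ∃ (V : ι → Op 𝓗) (K' : Op 𝓗), (∀ a, IsTraceless (V a)) ∧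
      ∀ A, L A = ∑ a, star (V a) * A * V a + (star K' * A + A * K') := by
  set c : ι → ℂ := fun a => opTrace 𝓗 (W a) / Module.finrank ℂ 𝓗 with hc
  set V : ι → Op 𝓗 := fun a => W a - c a • 1 with hV
  -- In the expansion of `(V a + c a)† A (V a + c a)`, all terms but `V a† A V a` are one-sided; `D
  -- a` collects them, with `|c a| ^ 2` split evenly between the two sides.
  set D : ι → Op 𝓗 := fun a => star (c a) • V a + (star (c a) * c a / 2) • 1 with hD
  refine ⟨V, K + ∑ a, D a, fun a => isTraceless_sub_smul_one (W a), fun A => ?_⟩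
  have hterm : ∀ a, star (W a) * A * W a = star (V a) * A * V a + (star (D a) * A + A * D a) := by
    intro a
    have hW : W a = V a + c a • 1 := by simp [hV]
    have h2 : star (star (c a) * c a / 2) = star (c a) * c a / 2 := by
      simp [mul_comm]
    rw [hW, hD]
    simp only [star_add, star_smul, star_one, h2, star_star]
    simp only [add_mul, mul_add, smul_mul_assoc, mul_smul_comm, one_mul, mul_one, smul_add,
      smul_smul]
    have h3 : (star (c a) * c a) • A =
        (star (c a) * c a / 2) • A + (star (c a) * c a / 2) • A := by
      rw [← add_smul, add_halves]
    rw [mul_comm (c a) (star (c a)), h3]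
    abel
  rw [hL]
  simp only [hterm, Finset.sum_add_distrib, star_add, star_sum, add_mul, mul_add, Finset.sum_mul,
    Finset.mul_sum]
  abel

/-- The normal form of a map `A ↦ ∑ r, W r† A W r + K† A + A K` that annihilates the identity. -/
theorem exists_hasGKSLForm [Nontrivial 𝓗] {N : ℕ} {L : SuperOp 𝓗} (V : Fin N → Op 𝓗) (K : Op 𝓗)
    (hL : ∀ A, L A = ∑ a, star (V a) * A * V a + (star K * A + A * K)) (h1 : L 1 = 0) :
    ∃ H : Op 𝓗, IsSelfAdjoint H ∧ IsTraceless H ∧ HasGKSLForm L H V := by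
  set S : Op 𝓗 := ∑ a, star (V a) * V a with hS
  -- Thus the Hermitian part of `K` is `-S / 2`, the anticommutator term; the anti-Hermitian part is
  -- `-i H₀`.
  have hSK : S = -(star K + K) := by
    rw [hL 1] at h1
    simp only [mul_one, one_mul] at h1
    exact eq_neg_of_add_eq_zero_left h1
  obtain ⟨H₀, hH₀⟩ : ∃ H₀ : Op 𝓗, H₀ = (Complex.I / 2) • (K - star K) := ⟨_, rfl⟩
  have hH₀s : star H₀ = H₀ := by
    rw [hH₀, star_smul, star_sub, star_star, ← neg_sub K, smul_neg, ← neg_smul]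
    congr 1
    simp [neg_div]
  -- A multiple of the identity drops out of the commutator, and `τ` is real, so subtracting it
  -- keeps the operator self-adjoint.
  set τ : ℂ := opTrace 𝓗 H₀ / Module.finrank ℂ 𝓗 with hτ
  have hτs : star τ = τ := by
    rw [hτ, star_div₀, ← opTrace_star, hH₀s, star_natCast]
  refine ⟨H₀ - τ • 1, ?_, isTraceless_sub_smul_one H₀, fun A => ?_⟩
  · rw [IsSelfAdjoint, star_sub, star_smul, star_one, hH₀s, hτs]
  · have hcomm : (H₀ - τ • 1) * A - A * (H₀ - τ • 1) = H₀ * A - A * H₀ := by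
      rw [sub_mul, mul_sub, smul_mul_assoc, mul_smul_comm, one_mul, mul_one]
      abel
    have hI : Complex.I • (H₀ * A - A * H₀) =
        (1 / 2 : ℂ) • ((star K - K) * A - A * (star K - K)) := by
      rw [hH₀, smul_mul_assoc, mul_smul_comm, ← smul_sub, smul_smul,
        show Complex.I * (Complex.I / 2) = -(1 / 2) by
          rw [← mul_div_assoc, Complex.I_mul_I]; norm_num, neg_smul, ← smul_neg]
      congr 1
      noncomm_ring
    rw [hcomm, hI, hL A, Finset.sum_sub_distrib, ← Finset.smul_sum, Finset.sum_add_distrib,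
      ← Finset.sum_mul, ← Finset.mul_sum, ← hS, hSK]
    have hhalf : ∀ X : Op 𝓗, X = (1 / 2 : ℂ) • (X + X) := fun X => by
      rw [← two_smul ℂ X, smul_smul]; norm_num
    rw [add_sub_assoc', add_comm _ (∑ a, star (V a) * A * V a), add_sub_assoc, ← smul_sub]
    congr 1
    rw [hhalf (star K * A + A * K)]
    congr 1
    noncomm_ring

/-- Generators of quantum dynamical semigroups have the GKSL form, with traceless `H` and `V j`
and `d ^ 2 - 1` operators `V j`. -/
theorem IsQDS.exists_hasGKSLForm [Nontrivial 𝓗] {Λ : ℝ≥0 → SuperOp 𝓗} {L : SuperOp 𝓗}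
    (hΛ : IsQDS Λ) (h : IsGenerator Λ L) :
    ∃ (H : Op 𝓗) (V : Fin (Module.finrank ℂ 𝓗 ^ 2 - 1) → Op 𝓗),
      IsSelfAdjoint H ∧ IsTraceless H ∧ (∀ j, IsTraceless (V j)) ∧ HasGKSLForm L H V := by
  have hstar := hΛ.generator_map_star h
  obtain ⟨Ψ, K, hK, hΨ⟩ := exists_cpForm_sub_nonneg hstar (hΛ.generator_cpForm_nonneg h)
  have hΨs : ∀ A, Ψ (star A) = star (Ψ A) := fun A => by
    have h1 : ∀ A, Ψ A = L A - (star K * A + A * K) := fun A => by rw [hK, add_sub_cancel_right]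
    rw [h1, h1, hstar, star_sub, star_add, star_mul, star_mul, star_star, add_comm]
  obtain ⟨d, W, hW⟩ := exists_kraus_of_cpForm_nonneg hΨs hΨ
  obtain ⟨V, K', hV, hVL⟩ := exists_isTraceless_kraus (L := L) W K fun A => by rw [hK, hW]
  have : FiniteDimensional ℂ (Op 𝓗) :=
    (LinearMap.toContinuousLinearMap (𝕜 := ℂ) (E := 𝓗) (F' := 𝓗)).finiteDimensional
  -- The traces are removed before the count is reduced: the reduction takes place inside the space
  -- of traceless operators.
  obtain ⟨V', hV', hVV⟩ := exists_kraus_of_finrank_eq finrank_ker_opTrace V hV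
  obtain ⟨H, hH, hHt, hHL⟩ := _root_.exists_hasGKSLForm V' K' (fun A => by rw [hVL, hVV])
    (hΛ.generator_map_one h)
  exact ⟨H, V', hH, hHt, hV', hHL⟩

end GKSLForm

theorem theorem1 (𝓗 : Type*) [NormedAddCommGroup 𝓗] [InnerProductSpace ℂ 𝓗] [CompleteSpace 𝓗]
    [FiniteDimensional ℂ 𝓗] :
    (∀ Λ : ℝ≥0 → SuperOp 𝓗, IsQDS Λ →
      (∃ L : SuperOp 𝓗, IsGenerator Λ L) ∧
      ∀ L : SuperOp 𝓗, IsGenerator Λ L →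
        (∀ t : ℝ≥0, Λ t = NormedSpace.exp ((t : ℝ) • L)) ∧
        (∃ (N : ℕ) (H : Op 𝓗) (V : Fin N → Op 𝓗),
          1 ≤ N ∧ IsSelfAdjoint H ∧ HasGKSLForm L H V) ∧
        (∃ (N : ℕ) (H : Op 𝓗) (V : Fin N → Op 𝓗),
          N ≤ Module.finrank ℂ 𝓗 ^ 2 - 1 ∧
          (2 ≤ Module.finrank ℂ 𝓗 → 1 ≤ N) ∧
          IsSelfAdjoint H ∧ IsTraceless H ∧ (∀ j, IsTraceless (V j)) ∧ HasGKSLForm L H V)) ∧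
    (∀ (L : SuperOp 𝓗) (N : ℕ) (H : Op 𝓗) (V : Fin N → Op 𝓗),
      IsSelfAdjoint H → HasGKSLForm L H V →
        IsQDS (fun t : ℝ≥0 => NormedSpace.exp ((t : ℝ) • L))) := by
  refine ⟨fun Λ hΛ => ?_, fun L N H V hH hL => hL.isQDS hH⟩
  obtain ⟨L₀, hL₀, hexp⟩ := hΛ.exists_generator
  refine ⟨⟨L₀, hL₀⟩, fun L hL => ?_⟩
  obtain rfl : L₀ = L := tendsto_nhds_unique hL₀ hL
  refine ⟨hexp, ?_⟩
  suffices hmain : ∃ (N : ℕ) (H : Op 𝓗) (V : Fin N → Op 𝓗),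
      N ≤ Module.finrank ℂ 𝓗 ^ 2 - 1 ∧ (2 ≤ Module.finrank ℂ 𝓗 → 1 ≤ N) ∧
        IsSelfAdjoint H ∧ IsTraceless H ∧ (∀ j, IsTraceless (V j)) ∧ HasGKSLForm L₀ H V by
    obtain ⟨N, H, V, -, -, hH, -, -, hform⟩ := id hmain
    exact ⟨⟨N + 1, H, Fin.cons 0 V, Nat.le_add_left 1 N, hH, hform.cons_zero⟩, hmain⟩
  cases subsingleton_or_nontrivial 𝓗
  -- Here `d = 0` and the truncated `d ^ 2 - 1` is `0`, so the family must be empty.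
  · refine ⟨0, 0, Fin.elim0, Nat.zero_le _, fun h => ?_, IsSelfAdjoint.zero _, map_zero _,
      fun j => j.elim0, HasGKSLForm.of_subsingleton _ _ _⟩
    rw [Module.finrank_zero_of_subsingleton] at h
    omega
  · obtain ⟨H, V, hH, hHt, hV, hform⟩ := hΛ.exists_hasGKSLForm hL
    -- `N` is exactly `d ^ 2 - 1`: it is `0` for `d = 1` and at least `3` for `d ≥ 2`.
    refine ⟨_, H, V, le_rfl, fun h => ?_, hH, hHt, hV, hform⟩
    have := Nat.pow_le_pow_left h 2
    omega
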